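/- Let $\mathbb{S}^3\subset\mathbb{C}^2$ be the unit sphere and let $t\in\mathbb{C}$ with $|t|<1$. On functions on $\mathbb{S}^3$ consider the tangential operators $$\mathcal{L}=\overline{z}_1\frac{\partial}{\partial z_2}-\overline{z}_2\frac{\partial}{\partial z_1},\qquad \overline{\mathcal{L}}=z_1\frac{\partial}{\partial\overline{z}_2}-z_2\frac{\partial}{\partial\overline{z}_1},\qquad \mathcal{L}_t=\mathcal{L}+\overline{t}\,\overline{\mathcal{L}},\qquad \overline{\mathcal{L}}_t=\overline{\mathcal{L}}+t\,\mathcal{L},$$ and the perturbed Kohn Laplacian of the Rossi sphere $$\square_b^t=-\mathcal{L}_t\,\frac{1+|t|^2}{(1-|t|^2)^2}\,\overline{\mathcal{L}}_t .$$ For $k\ge 0$ let $\mathcal{H}_k(\mathbb{S}^3)$ be the space of restrictions to $\mathbb{S}^3$ of the complex polynomials in $z_1,z_2,\overline{z}_1,\overline{z}_2$ that are homogeneous of total degree $k$ and harmonic, i.e. annihilated by $4\sum_{j=1}^{2}\frac{\partial^2}{\partial z_j\partial\overline{z}_j}$. Then $\square_b^t$ maps $\mathcal{H}_k(\mathbb{S}^3)$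 into itself, its eigenvalues on $\mathcal{H}_k(\mathbb{S}^3)$ are real, and they have a largest element $\lambda_k^{\max}$. Moreover, there is a real constant $c>0$ (depending on $t$ but not on $k$) such that $$\frac1c\,k^2\le\lambda_k^{\max}\le c\,k^2\qquad\text{for all } k\ge 0;$$ in particular $\lambda_k^{\max}=\Theta(k^2)$ as $k\to\infty$. -/

import Mathlib

open Asymptotics Filter

namespace RossiSphere

noncomputable section

/-- The space `ℂ²` with its Euclidean norm; `z 0` and `z 1` are the coordinates `z₁` and `z₂`. -/
abbrev C2 : Type := EuclideanSpace ℂ (Fin 2)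

/-- The unit sphere `S³` in `ℂ²`. -/
abbrev S3 : Type := Metric.sphere (0 : C2) 1

/-! ### Spherical harmonics -/

/-- Complex polynomials in `z₁, z₂, z̄₁, z̄₂`: the variable `Sum.inl j` stands for `z_j` and
`Sum.inr j` for its conjugate. -/
abbrev Poly : Type := MvPolynomial (Fin 2 ⊕ Fin 2) ℂ

/-- The Laplacian `4 ∑ⱼ ∂²/∂z_j∂z̄_j` on polynomials in `z` and `z̄`. -/
def laplacian : Poly →ₗ[ℂ] Poly :=
  (4 : ℂ) • ∑ j : Fin 2,
    ((MvPolynomial.pderiv (R := ℂ) (Sum.inl j : Fin 2 ⊕ Fin 2)).toLinearMap ∘ₗ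
      (MvPolynomial.pderiv (R := ℂ) (Sum.inr j : Fin 2 ⊕ Fin 2)).toLinearMap)

/-- `H_k(ℂ²)`: harmonic polynomials in `z, z̄`, homogeneous of (total) degree `k`. -/
def harmonicPoly (k : ℕ) : Submodule ℂ Poly :=
  MvPolynomial.homogeneousSubmodule (Fin 2 ⊕ Fin 2) ℂ k ⊓ LinearMap.ker laplacian

/-- Restriction to `S³` of a polynomial in `z, z̄`, as a complex-valued function. -/
def restrictToSphere : Poly →ₗ[ℂ] (S3 → ℂ) where
  toFun P := fun z =>
    MvPolynomial.eval (Sum.elim (fun j => z.1 j) (fun j => starRingEnd ℂ (z.1 j))) P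
  map_add' P Q := by
    funext z
    simp
  map_smul' a P := by
    funext z
    simp [MvPolynomial.smul_eval]

/-- `H_k(S³)`: the spherical harmonics of degree `k`. -/
def sphericalHarmonics (k : ℕ) : Submodule ℂ (S3 → ℂ) :=
  (harmonicPoly k).map restrictToSphere

/-! ### Differential operators on the sphere -/

/-- The extension of a function on `S³` to `ℂ²` that is constant along rays (and `0` at the
origin). -/
def radialExtension (f : S3 → ℂ) (w : C2) : ℂ :=
  open Classical in
  if h : w = 0 then 0 else
    f ⟨(‖w‖⁻¹ : ℝ) • w, by
      rw [mem_sphere_zero_iff_norm, norm_smul, norm_inv, norm_norm]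
      exact inv_mul_cancel₀ (norm_ne_zero_iff.mpr h)⟩

/-- The Wirtinger derivative `∂F/∂z_j = (∂F/∂x_j - i ∂F/∂y_j) / 2`. -/
def dz (j : Fin 2) (F : C2 → ℂ) (w : C2) : ℂ :=
  (fderiv ℝ F w (EuclideanSpace.single j 1)
    - Complex.I * fderiv ℝ F w (EuclideanSpace.single j Complex.I)) / 2

/-- The Wirtinger derivative `∂F/∂z̄_j = (∂F/∂x_j + i ∂F/∂y_j) / 2`. -/
def dzbar (j : Fin 2) (F : C2 → ℂ) (w : C2) : ℂ :=
  (fderiv ℝ F w (EuclideanSpace.single j 1)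
    + Complex.I * fderiv ℝ F w (EuclideanSpace.single j Complex.I)) / 2

/-- `ℒ = z̄₁ ∂/∂z₂ - z̄₂ ∂/∂z₁` on functions on `S³`. This vector field is tangent to `S³`, so
any differentiable extension of `f` gives the same result; we use the radial one. -/
def opL (f : S3 → ℂ) : S3 → ℂ := fun z =>
  starRingEnd ℂ (z.1 0) * dz 1 (radialExtension f) z.1
    - starRingEnd ℂ (z.1 1) * dz 0 (radialExtension f) z.1

/-- The conjugate operator `ℒ̄ = z₁ ∂/∂z̄₂ - z₂ ∂/∂z̄₁` on functions on `S³`. -/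
def opLbar (f : S3 → ℂ) : S3 → ℂ := fun z =>
  z.1 0 * dzbar 1 (radialExtension f) z.1 - z.1 1 * dzbar 0 (radialExtension f) z.1

/-- `ℒ_t = ℒ + t̄ ℒ̄`. -/
def opLt (t : ℂ) (f : S3 → ℂ) : S3 → ℂ :=
  opL f + starRingEnd ℂ t • opLbar f

/-- The conjugate of `ℒ_t`, namely `ℒ̄ + t ℒ`. -/
def opLtbar (t : ℂ) (f : S3 → ℂ) : S3 → ℂ :=
  opLbar f + t • opL f

/-- The perturbed Kohn Laplacian `□_b^t = - ℒ_t ((1 + |t|²) / (1 - |t|²)²) ℒ̄_t` of the Rossi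
sphere. -/
def boxbt (t : ℂ) (f : S3 → ℂ) : S3 → ℂ :=
  - opLt t ((((1 + ‖t‖ ^ 2) / (1 - ‖t‖ ^ 2) ^ 2 : ℝ) : ℂ) • opLtbar t f)

/-- The eigenvalues of `□_b^t` on `H_k(S³)`. -/
def eigenvaluesOn (t : ℂ) (k : ℕ) : Set ℂ :=
  {μ | ∃ f ∈ sphericalHarmonics k, f ≠ 0 ∧ boxbt t f = μ • f}

/-- `λ_k^max`, the largest eigenvalue of `□_b^t` on `H_k(S³)`. -/
def lambdaMax (t : ℂ) (k : ℕ) : ℝ :=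
  sSup {r : ℝ | (r : ℂ) ∈ eigenvaluesOn t k}

end

end RossiSphere

/-!
The proof moves the problem from functions on the sphere to polynomials in `z, z̄`.

The vector fields `ℒ` and `ℒ̄` are tangent to `S³`, so on the restriction of a polynomial they act
through the polynomial operators given by the same formulas (`opL_restrictToSphere`,
`opLbar_restrictToSphere`): the radial extension differs from the polynomial, to first order, only
in the radial direction, and this contribution cancels. Both operators commute with the Laplacian
and preserve the degree, and the restriction to `S³` is injective on homogeneous polynomials
(`eq_zero_of_restrictToSphere_eq_zero`). Hence the spectrum of `□_b^t` on `H_k(S³)` is that of a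
polynomial operator on `H_k(ℂ²)` (`mem_eigenvaluesOn_iff`).

On polynomials the Fischer inner product `⟨P, Q⟩ = ∑ α! · conj (coeff α P) · coeff α Q` makes
multiplication by a variable adjoint to differentiation in that variable (`fischer_X_mul_left`).
Hence `ℒ` is minus the adjoint of `ℒ̄`, and `ℒ_t` minus the adjoint of `ℒ̄_t`, so that with
`C = (1 + |t|²) / (1 - |t|²)²` one has `⟨□ P, P⟩ = C ‖ℒ̄_t P‖²`. Thus `□` is symmetric, its
eigenvalues are real, and the largest one is the maximum of `C ‖ℒ̄_t P‖² / ‖P‖²` over `H_k(ℂ²)`.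

* Upper bound: by Euler's identity and the commutation of `∂ᵢ` with `zᵢ`, the operator `zᵢ ∂ⱼ` has
  norm at most `k` in degree `k` (`fischer_X_mul_pderiv_self_re_le`), whence
  `‖ℒ̄_t P‖² ≤ 16 k² ‖P‖²`.
* Lower bound: for `P = z₁^p z̄₂^q` the polynomials `ℒ̄ P` and `ℒ P` are orthogonal, and
  `‖ℒ̄ P‖² = q (p + 1) ‖P‖²`; taking `p = ⌊k/2⌋` and `q = ⌈k/2⌉` gives
  `‖ℒ̄_t P‖² ≥ k² / 4 · ‖P‖²`.
-/

namespace RossiSphere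

open MvPolynomial ComplexConjugate

/-! ### The Fischer inner product on polynomials -/

section Fischer

variable {σ : Type*} [Fintype σ]

/-- The squared Fischer norm `α! = ∏ᵢ αᵢ!` of the monomial with exponent `α`. -/
def multiFactorial (α : σ →₀ ℕ) : ℕ := ∏ i, (α i).factorial

lemma multiFactorial_pos (α : σ →₀ ℕ) : 0 < multiFactorial α :=
  Finset.prod_pos fun _ _ => Nat.factorial_pos _

lemma multiFactorial_single_add (i : σ) (α : σ →₀ ℕ) :
    multiFactorial (Finsupp.single i 1 + α) = (α i + 1) * multiFactorial α := by
  classical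
  unfold multiFactorial
  rw [← Finset.mul_prod_erase _ _ (Finset.mem_univ i),
    ← Finset.mul_prod_erase _ (fun j => (α j).factorial) (Finset.mem_univ i), ← mul_assoc]
  congr 1
  · simp [add_comm 1, Nat.factorial_succ]
  · refine Finset.prod_congr rfl fun j hj => ?_
    simp [(Finset.ne_of_mem_erase hj).symm]

/-- The Fischer inner product `∑ α! · conj (coeff α P) · coeff α Q`, conjugate-linear in the first
argument. -/
noncomputable def fischer (P Q : MvPolynomial σ ℂ) : ℂ :=
  ∑ α ∈ P.support, (multiFactorial α : ℂ) * conj (coeff α P) * coeff α Q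

lemma fischer_eq_sum {P : MvPolynomial σ ℂ} (Q : MvPolynomial σ ℂ) {S : Finset (σ →₀ ℕ)}
    (h : P.support ⊆ S) :
    fischer P Q = ∑ α ∈ S, (multiFactorial α : ℂ) * conj (coeff α P) * coeff α Q := by
  refine Finset.sum_subset h fun α _ hα => ?_
  simp [notMem_support_iff.mp hα]

lemma fischer_add_left (P Q R : MvPolynomial σ ℂ) :
    fischer (P + Q) R = fischer P R + fischer Q R := by
  classical
  rw [fischer_eq_sum R (support_add (p := P) (q := Q)),
    fischer_eq_sum R (Finset.subset_union_left (s₁ := P.support) (s₂ := Q.support)),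
    fischer_eq_sum R (Finset.subset_union_right (s₁ := P.support) (s₂ := Q.support)),
    ← Finset.sum_add_distrib]
  refine Finset.sum_congr rfl fun α _ => ?_
  simp only [coeff_add, map_add]
  ring

lemma fischer_add_right (P Q R : MvPolynomial σ ℂ) :
    fischer P (Q + R) = fischer P Q + fischer P R := by
  simp only [fischer, ← Finset.sum_add_distrib, coeff_add, mul_add]

lemma fischer_smul_left (c : ℂ) (P Q : MvPolynomial σ ℂ) :
    fischer (c • P) Q = conj c * fischer P Q := by
  rw [fischer_eq_sum Q (support_smul (a := c) (f := P)), fischer, Finset.mul_sum]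
  refine Finset.sum_congr rfl fun α _ => ?_
  simp only [coeff_smul, smul_eq_mul, map_mul]
  ring

lemma fischer_smul_right (c : ℂ) (P Q : MvPolynomial σ ℂ) :
    fischer P (c • Q) = c * fischer P Q := by
  rw [fischer, fischer, Finset.mul_sum]
  refine Finset.sum_congr rfl fun α _ => ?_
  simp only [coeff_smul, smul_eq_mul]
  ring

lemma fischer_neg_left (P Q : MvPolynomial σ ℂ) : fischer (-P) Q = -fischer P Q := by
  simpa using fischer_smul_left (-1) P Q

lemma fischer_neg_right (P Q : MvPolynomial σ ℂ) : fischer P (-Q) = -fischer P Q := by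
  simpa using fischer_smul_right (-1) P Q

lemma fischer_sub_left (P Q R : MvPolynomial σ ℂ) :
    fischer (P - Q) R = fischer P R - fischer Q R := by
  rw [sub_eq_add_neg, fischer_add_left, fischer_neg_left, sub_eq_add_neg]

lemma fischer_sub_right (P Q R : MvPolynomial σ ℂ) :
    fischer P (Q - R) = fischer P Q - fischer P R := by
  rw [sub_eq_add_neg, fischer_add_right, fischer_neg_right, sub_eq_add_neg]

lemma fischer_sum_right {ι : Type*} (s : Finset ι) (P : MvPolynomial σ ℂ)
    (Q : ι → MvPolynomial σ ℂ) : fischer P (∑ i ∈ s, Q i) = ∑ i ∈ s, fischer P (Q i) := by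
  simp only [fischer, coeff_sum, Finset.mul_sum]
  exact Finset.sum_comm

lemma conj_fischer (P Q : MvPolynomial σ ℂ) : conj (fischer Q P) = fischer P Q := by
  classical
  rw [fischer_eq_sum Q (Finset.subset_union_left (s₁ := P.support) (s₂ := Q.support)),
    fischer_eq_sum P (Finset.subset_union_right (s₁ := P.support) (s₂ := Q.support)), map_sum]
  refine Finset.sum_congr rfl fun α _ => ?_
  simp only [map_mul, Complex.conj_conj, Complex.conj_natCast]
  ring

lemma fischer_self (P : MvPolynomial σ ℂ) :
    fischer P P = ((∑ α ∈ P.support, multiFactorial α * ‖coeff α P‖ ^ 2 : ℝ) : ℂ) := by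
  rw [fischer, Complex.ofReal_sum]
  refine Finset.sum_congr rfl fun α _ => ?_
  rw [mul_assoc, Complex.conj_mul']
  push_cast
  rfl

lemma fischer_self_re_nonneg (P : MvPolynomial σ ℂ) : 0 ≤ (fischer P P).re := by
  rw [fischer_self, Complex.ofReal_re]
  positivity

lemma fischer_self_re_pos {P : MvPolynomial σ ℂ} (hP : P ≠ 0) : 0 < (fischer P P).re := by
  rw [fischer_self, Complex.ofReal_re]
  refine Finset.sum_pos (fun α hα => ?_) (by simpa using hP)
  have h1 : (0 : ℝ) < multiFactorial α := by exact_mod_cast multiFactorial_pos α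
  have h2 := norm_pos_iff.mpr (mem_support_iff.mp hα)
  positivity

lemma fischer_monomial_left (α : σ →₀ ℕ) (Q : MvPolynomial σ ℂ) :
    fischer (monomial α 1) Q = multiFactorial α * coeff α Q := by
  classical
  rw [fischer_eq_sum Q (support_monomial_subset (s := α) (a := (1 : ℂ)))]
  simp

/-- Multiplication by a variable is adjoint to the partial derivative in that variable. -/
lemma fischer_X_mul_left (i : σ) (P Q : MvPolynomial σ ℂ) :
    fischer (X i * P) Q = fischer P (pderiv i Q) := by
  rw [fischer, support_X_mul, Finset.sum_map, fischer]
  refine Finset.sum_congr rfl fun α _ => ?_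
  simp only [addLeftEmbedding_apply, coeff_X_mul, multiFactorial_single_add, coeff_pderiv,
    add_comm α]
  push_cast
  ring

lemma fischer_pderiv_left (i : σ) (P Q : MvPolynomial σ ℂ) :
    fischer (pderiv i P) Q = fischer P (X i * Q) := by
  rw [← conj_fischer, ← fischer_X_mul_left, conj_fischer]

lemma fischer_add_self_re_le (P Q : MvPolynomial σ ℂ) :
    (fischer (P + Q) (P + Q)).re ≤ 2 * (fischer P P).re + 2 * (fischer Q Q).re := by
  have h := fischer_self_re_nonneg (P - Q)
  simp only [fischer_sub_left, fischer_sub_right, Complex.sub_re] at h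
  simp only [fischer_add_left, fischer_add_right, Complex.add_re]
  linarith

lemma fischer_smul_self_re (c : ℂ) (P : MvPolynomial σ ℂ) :
    (fischer (c • P) (c • P)).re = ‖c‖ ^ 2 * (fischer P P).re := by
  rw [fischer_smul_left, fischer_smul_right, ← mul_assoc, Complex.conj_mul', ← Complex.ofReal_pow,
    Complex.re_ofReal_mul]

/-- Euler's identity makes the squared norms of the first derivatives of a homogeneous polynomial
of degree `k` add up to `k` times its own. -/
lemma fischer_pderiv_self_re_le {k : ℕ} {P : MvPolynomial σ ℂ} (hP : P.IsHomogeneous k) (i : σ) :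
    (fischer (pderiv i P) (pderiv i P)).re ≤ k * (fischer P P).re := by
  have h : ∑ j, fischer (pderiv j P) (pderiv j P) = k * fischer P P := by
    simp only [fischer_pderiv_left]
    rw [← fischer_sum_right, hP.sum_X_mul_pderiv, ← Nat.cast_smul_eq_nsmul ℂ, fischer_smul_right]
  have h' := congrArg Complex.re h
  rw [Complex.re_sum, ← Complex.ofReal_natCast, Complex.re_ofReal_mul] at h'
  rw [← h']
  exact Finset.single_le_sum (f := fun j => (fischer (pderiv j P) (pderiv j P)).re)
    (fun j _ => fischer_self_re_nonneg _) (Finset.mem_univ i)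

lemma fischer_X_mul_self_re_le {k : ℕ} {P : MvPolynomial σ ℂ} (hP : P.IsHomogeneous k) (i : σ) :
    (fischer (X i * P) (X i * P)).re ≤ (k + 1) * (fischer P P).re := by
  have h : fischer (X i * P) (X i * P)
      = fischer P P + fischer (pderiv i P) (pderiv i P) := by
    rw [fischer_X_mul_left, pderiv_mul, pderiv_X_self, one_mul, fischer_add_right,
      fischer_pderiv_left]
  rw [h, Complex.add_re]
  linarith [fischer_pderiv_self_re_le hP i]

lemma fischer_X_mul_pderiv_self_re_le {k : ℕ} {P : MvPolynomial σ ℂ} (hP : P.IsHomogeneous k)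
    (i j : σ) :
    (fischer (X i * pderiv j P) (X i * pderiv j P)).re ≤ (k : ℝ) ^ 2 * (fischer P P).re := by
  obtain _ | k := k
  · have h := fischer_pderiv_self_re_le hP j
    have h' := fischer_X_mul_self_re_le (hP.pderiv (i := j)) i
    simp only [Nat.cast_zero, zero_mul, zero_tsub] at h h'
    simp only [Nat.cast_zero]
    linarith
  · have h := fischer_pderiv_self_re_le hP j
    have h' := fischer_X_mul_self_re_le (k := k) (hP.pderiv (i := j)) i
    push_cast at h ⊢
    nlinarith

end Fischer

/-! ### Symmetric operators on finite-dimensional spaces -/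

/-- A symmetric operator on a nonzero finite-dimensional space has an eigenvalue that bounds its
Rayleigh quotient. The inner product is passed as data, since the space of interest carries no
norm. -/
lemma exists_hasEigenvalue_re_inner_le {V : Type*} [AddCommGroup V] [Module ℂ V]
    [FiniteDimensional ℂ V] [Nontrivial V] (c : InnerProductSpace.Core ℂ V) (T : V →ₗ[ℂ] V)
    (hT : ∀ x y, c.inner (T x) y = c.inner x (T y)) :
    ∃ r : ℝ, Module.End.HasEigenvalue T (r : ℂ) ∧
      ∀ x, (c.inner (T x) x).re ≤ r * (c.inner x x).re := by
  let : NormedAddCommGroup V := c.toNormedAddCommGroup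
  let : InnerProductSpace ℂ V := InnerProductSpace.ofCore c.toCore
  have hsym : T.IsSymmetric := hT
  refine ⟨_, hsym.hasEigenvalue_iSup_of_finiteDimensional, fun x => ?_⟩
  change RCLike.re (inner ℂ (T x) x) ≤ _ * RCLike.re (inner ℂ x x)
  rw [inner_self_eq_norm_sq]
  rcases eq_or_ne x 0 with rfl | hx
  · simp
  have hx' : 0 < ‖x‖ ^ 2 := by positivity
  rw [← div_le_iff₀ hx']
  refine le_ciSup (f := fun x : {x : V // x ≠ 0} =>
    RCLike.re (inner ℂ (T x) (x : V)) / ‖(x : V)‖ ^ 2) ?_ ⟨x, hx⟩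
  refine ⟨‖LinearMap.toContinuousLinearMap T‖, ?_⟩
  rintro _ ⟨⟨y, hy⟩, rfl⟩
  have hy' : 0 < ‖y‖ ^ 2 := by positivity
  rw [div_le_iff₀ hy']
  calc RCLike.re (inner ℂ (T y) y) ≤ ‖T y‖ * ‖y‖ := re_inner_le_norm _ _
    _ ≤ ‖LinearMap.toContinuousLinearMap T‖ * ‖y‖ * ‖y‖ := by
        gcongr
        exact (LinearMap.toContinuousLinearMap T).le_opNorm y
    _ = _ := by ring

/-! ### The polynomial models of `ℒ` and `ℒ̄` -/

lemma pderiv_comm {σ R : Type*} [CommSemiring R] (i j : σ) (P : MvPolynomial σ R) :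
    pderiv i (pderiv j P) = pderiv j (pderiv i P) := by
  classical
  ext m
  simp only [coeff_pderiv, Finsupp.add_apply, Finsupp.single_apply, add_right_comm m]
  rcases eq_or_ne i j with rfl | h
  · rfl
  · simp only [h, h.symm, if_false]
    push_cast
    ring

/-- `ℒ = z̄₁ ∂/∂z₂ - z̄₂ ∂/∂z₁` on polynomials in `z, z̄`. -/
noncomputable def polyL : Poly →ₗ[ℂ] Poly :=
  LinearMap.mulLeft ℂ (X (Sum.inr 0)) ∘ₗ (pderiv (Sum.inl 1)).toLinearMap
    - LinearMap.mulLeft ℂ (X (Sum.inr 1)) ∘ₗ (pderiv (Sum.inl 0)).toLinearMap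

/-- `ℒ̄ = z₁ ∂/∂z̄₂ - z₂ ∂/∂z̄₁` on polynomials in `z, z̄`. -/
noncomputable def polyLbar : Poly →ₗ[ℂ] Poly :=
  LinearMap.mulLeft ℂ (X (Sum.inl 0)) ∘ₗ (pderiv (Sum.inr 1)).toLinearMap
    - LinearMap.mulLeft ℂ (X (Sum.inl 1)) ∘ₗ (pderiv (Sum.inr 0)).toLinearMap

lemma polyL_apply (P : Poly) :
    polyL P = X (Sum.inr 0) * pderiv (Sum.inl 1) P - X (Sum.inr 1) * pderiv (Sum.inl 0) P := rfl

lemma polyLbar_apply (P : Poly) :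
    polyLbar P = X (Sum.inl 0) * pderiv (Sum.inr 1) P - X (Sum.inl 1) * pderiv (Sum.inr 0) P := rfl

lemma laplacian_apply (P : Poly) :
    laplacian P = (4 : ℂ) • (pderiv (Sum.inl 0) (pderiv (Sum.inr 0) P)
      + pderiv (Sum.inl 1) (pderiv (Sum.inr 1) P)) := by
  simp [laplacian, Fin.sum_univ_two]

lemma laplacian_polyL (P : Poly) : laplacian (polyL P) = polyL (laplacian P) := by
  have h1 (a b : Fin 2) (Q : Poly) := pderiv_comm (Sum.inr a) (Sum.inl b) Q
  have h2 (Q : Poly) := pderiv_comm (Sum.inl 1) (Sum.inl 0) Q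
  simp only [laplacian_apply, map_smul]
  congr 1
  simp only [polyL_apply, map_sub, map_add, Derivation.leibniz, pderiv_X, smul_eq_mul,
    Pi.single_apply]
  simp [h1, h2]
  ring

lemma laplacian_polyLbar (P : Poly) : laplacian (polyLbar P) = polyLbar (laplacian P) := by
  have h1 (a b : Fin 2) (Q : Poly) := pderiv_comm (Sum.inr a) (Sum.inl b) Q
  have h2 (Q : Poly) := pderiv_comm (Sum.inr 1) (Sum.inr 0) Q
  simp only [laplacian_apply, map_smul]
  congr 1
  simp only [polyLbar_apply, map_sub, map_add, Derivation.leibniz, pderiv_X, smul_eq_mul,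
    Pi.single_apply]
  simp [h1, h2]
  ring

lemma isHomogeneous_X_mul_pderiv {σ : Type*} {k : ℕ} {P : MvPolynomial σ ℂ}
    (hP : P.IsHomogeneous k) (i j : σ) : (X i * pderiv j P).IsHomogeneous k := by
  obtain _ | k := k
  · rw [← totalDegree_zero_iff_isHomogeneous, totalDegree_eq_zero_iff_eq_C] at hP
    rw [hP, pderiv_C, mul_zero]
    exact isHomogeneous_zero ..
  · simpa [add_comm] using (isHomogeneous_X ℂ i).mul (hP.pderiv (i := j))

lemma polyL_mem_harmonicPoly {k : ℕ} {P : Poly} (hP : P ∈ harmonicPoly k) :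
    polyL P ∈ harmonicPoly k := by
  obtain ⟨h1, h2⟩ := hP
  refine ⟨?_, ?_⟩
  · exact (homogeneousSubmodule _ ℂ k).sub_mem (isHomogeneous_X_mul_pderiv h1 _ _)
      (isHomogeneous_X_mul_pderiv h1 _ _)
  · change laplacian (polyL P) = 0
    rw [laplacian_polyL, LinearMap.mem_ker.mp h2, map_zero]

lemma polyLbar_mem_harmonicPoly {k : ℕ} {P : Poly} (hP : P ∈ harmonicPoly k) :
    polyLbar P ∈ harmonicPoly k := by
  obtain ⟨h1, h2⟩ := hP
  refine ⟨?_, ?_⟩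
  · exact (homogeneousSubmodule _ ℂ k).sub_mem (isHomogeneous_X_mul_pderiv h1 _ _)
      (isHomogeneous_X_mul_pderiv h1 _ _)
  · change laplacian (polyLbar P) = 0
    rw [laplacian_polyLbar, LinearMap.mem_ker.mp h2, map_zero]

/-! ### Restriction to the sphere -/

/-- The function `w ↦ P(w, w̄)` on `ℂ²`. -/
noncomputable def evalConj (P : Poly) (w : C2) : ℂ :=
  eval (Sum.elim (fun j => w j) (fun j => conj (w j))) P

lemma restrictToSphere_apply (P : Poly) (z : S3) : restrictToSphere P z = evalConj P z.1 := rfl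

lemma eval_smul_of_isHomogeneous {σ R : Type*} [CommSemiring R] {k : ℕ}
    {P : MvPolynomial σ R} (hP : P.IsHomogeneous k) (r : R) (v : σ → R) :
    eval (fun i => r * v i) P = r ^ k * eval v P := by
  rw [eval_eq, eval_eq, Finset.mul_sum]
  refine Finset.sum_congr rfl fun α hα => ?_
  have h : ∑ i ∈ α.support, α i = k := by
    rw [← hP (mem_support_iff.mp hα), Pi.one_def, ← Finsupp.degree_eq_weight_one]
    rfl
  simp only [mul_pow, Finset.prod_mul_distrib, Finset.prod_pow_eq_pow_sum, h]
  ring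

/-- A polynomial in `z, z̄` is determined by its values at the points of `ℂ²`: substituting
`z = x + iy` turns these into its values at real points. -/
lemma eq_zero_of_evalConj_eq_zero {P : Poly} (h : ∀ w, evalConj P w = 0) : P = 0 := by
  set s : Fin 2 ⊕ Fin 2 → Poly := Sum.elim
    (fun j => X (Sum.inl j) + C Complex.I * X (Sum.inr j))
    (fun j => X (Sum.inl j) - C Complex.I * X (Sum.inr j)) with hs
  have key : ∀ x : Fin 2 ⊕ Fin 2 → ℂ, eval x (bind₁ s P) = eval (fun i => eval x (s i)) P := by
    intro x
    exact eval₂Hom_bind₁ _ _ _ _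
  have hzero : bind₁ s P = 0 := by
    refine funext_set (fun _ => Set.range ((↑) : ℝ → ℂ))
      (fun _ => Set.infinite_range_of_injective Complex.ofReal_injective) fun x hx => ?_
    rw [key, map_zero, ← h (WithLp.toLp 2 fun j => x (Sum.inl j) + Complex.I * x (Sum.inr j))]
    have hx' : ∀ i, conj (x i) = x i := fun i => by
      obtain ⟨r, hr⟩ := hx i trivial
      rw [← hr, Complex.conj_ofReal]
    unfold evalConj
    congr 2
    funext i
    rcases i with j | j
    · simp [hs]
    · simp [hs, hx', sub_eq_add_neg]
  refine MvPolynomial.funext fun y => ?_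
  have h2 := key (Sum.elim (fun j => (y (Sum.inl j) + y (Sum.inr j)) / 2)
    (fun j => (y (Sum.inl j) - y (Sum.inr j)) / (2 * Complex.I)))
  rw [hzero, map_zero] at h2
  rw [map_zero, h2]
  congr 2
  funext i
  rcases i with j | j
  · simp only [hs, Sum.elim_inl, map_add, map_mul, eval_X, eval_C, Sum.elim_inr]
    field_simp [Complex.I_ne_zero]
    ring
  · simp only [hs, Sum.elim_inl, map_sub, map_mul, eval_X, eval_C, Sum.elim_inr]
    field_simp [Complex.I_ne_zero]
    ring

lemma evalConj_real_smul {k : ℕ} {P : Poly} (hP : P.IsHomogeneous k) (r : ℝ) (w : C2) :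
    evalConj P (r • w) = (r : ℂ) ^ k * evalConj P w := by
  rw [evalConj, evalConj, ← eval_smul_of_isHomogeneous hP]
  congr 2
  funext i
  rcases i with j | j <;> simp

/-- Homogeneous polynomials in `z, z̄` are determined by their restriction to the sphere. -/
lemma eq_zero_of_restrictToSphere_eq_zero {k : ℕ} {P : Poly} (hP : P.IsHomogeneous k)
    (h : restrictToSphere P = 0) : P = 0 := by
  have hne : ∀ w : C2, w ≠ 0 → evalConj P w = 0 := fun w hw => by
    have hw' : ‖w‖ ≠ 0 := norm_ne_zero_iff.mpr hw
    have hmem : (‖w‖⁻¹ : ℝ) • w ∈ Metric.sphere (0 : C2) 1 := by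
      rw [mem_sphere_zero_iff_norm, norm_smul, norm_inv, norm_norm, inv_mul_cancel₀ hw']
    have h1 : evalConj P ((‖w‖⁻¹ : ℝ) • w) = 0 := congrFun h ⟨_, hmem⟩
    have h2 := evalConj_real_smul hP ‖w‖ ((‖w‖⁻¹ : ℝ) • w)
    rwa [h1, mul_zero, smul_smul, mul_inv_cancel₀ hw', one_smul] at h2
  -- Only the origin is left; multiplying by a coordinate removes it.
  have hX : X (Sum.inl 0) * P = 0 := eq_zero_of_evalConj_eq_zero fun w => by
    rcases eq_or_ne w 0 with rfl | hw
    · simp [evalConj]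
    · have := hne w hw
      unfold evalConj at this ⊢
      rw [map_mul, this, mul_zero]
  exact (mul_eq_zero.mp hX).resolve_left (X_ne_zero _)

/-! ### The tangential operators on restrictions of polynomials -/

/-- The real differential of `w ↦ P(w, w̄)`, in terms of the formal derivatives of `P`. -/
lemma hasFDerivAt_evalConj (P : Poly) (w : C2) :
    ∃ D : C2 →L[ℝ] ℂ, HasFDerivAt (evalConj P) D w ∧ ∀ v, D v =
      ∑ j, (evalConj (pderiv (Sum.inl j) P) w * v j
        + evalConj (pderiv (Sum.inr j) P) w * conj (v j)) := by
  induction P using MvPolynomial.induction_on with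
  | C a =>
    refine ⟨0, ?_, fun v => by simp [evalConj]⟩
    have : evalConj (C a) = fun _ => a := by funext w; simp [evalConj]
    rw [this]
    exact hasFDerivAt_const a w
  | add P Q hP hQ =>
    obtain ⟨D, hD, hD'⟩ := hP
    obtain ⟨E, hE, hE'⟩ := hQ
    refine ⟨D + E, ?_, fun v => ?_⟩
    · have : evalConj (P + Q) = evalConj P + evalConj Q := by funext w; simp [evalConj]
      rw [this]
      exact hD.add hE
    · simp only [add_apply, hD', hE', Fin.sum_univ_two, evalConj, map_add]
      ring
  | mul_X P i hP =>
    obtain ⟨D, hD, hD'⟩ := hP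
    have hmul : evalConj (P * X i) = fun w => evalConj P w * evalConj (X i) w := by
      funext w; simp [evalConj]
    have hX : ∃ E : C2 →L[ℝ] ℂ, HasFDerivAt (evalConj (X i)) E w ∧
        ∀ v, E v = Sum.elim (fun j => v j) (fun j => conj (v j)) i := by
      rcases i with j | j
      · refine ⟨(EuclideanSpace.proj (𝕜 := ℂ) j).restrictScalars ℝ, ?_, fun v => by simp⟩
        have : evalConj (X (Sum.inl j)) = (EuclideanSpace.proj (𝕜 := ℂ) j).restrictScalars ℝ := by
          funext w; simp [evalConj]
        rw [this]
        exact ContinuousLinearMap.hasFDerivAt _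
      · refine ⟨Complex.conjCLE.toContinuousLinearMap ∘L
          (EuclideanSpace.proj (𝕜 := ℂ) j).restrictScalars ℝ, ?_, fun v => by simp⟩
        have : evalConj (X (Sum.inr j)) = Complex.conjCLE.toContinuousLinearMap ∘L
            (EuclideanSpace.proj (𝕜 := ℂ) j).restrictScalars ℝ := by
          funext w; simp [evalConj]
        rw [this]
        exact ContinuousLinearMap.hasFDerivAt _
    obtain ⟨E, hE, hE'⟩ := hX
    refine ⟨_, (hD.mul hE).congr_of_eventuallyEq (Filter.Eventually.of_forall fun w => ?_),
      fun v => ?_⟩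
    · exact congrFun hmul w
    simp only [add_apply, smul_apply, hD', hE', pderiv_mul,
      Fin.sum_univ_two, smul_eq_mul]
    rcases i with j | j <;> fin_cases j <;> simp [evalConj, pderiv_X] <;> ring

lemma radialExtension_restrictToSphere (P : Poly) {w : C2} (hw : w ≠ 0) :
    radialExtension (restrictToSphere P) w = evalConj P ((‖w‖⁻¹ : ℝ) • w) := by
  simp [radialExtension, hw, restrictToSphere_apply]

lemma hasFDerivAt_normalize {z : C2} (hz : ‖z‖ = 1) :
    ∃ D : C2 →L[ℝ] C2, HasFDerivAt (fun w : C2 => (‖w‖⁻¹ : ℝ) • w) D z ∧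
      ∀ v, D v = v - (∑ j, conj (z j) * v j).re • z := by
  have h1 : HasFDerivAt (fun w : C2 => ‖w‖ ^ 2) (2 • (innerSL ℝ z : C2 →L[ℝ] ℝ)) z :=
    (hasStrictFDerivAt_norm_sq z).hasFDerivAt
  have h2 : HasFDerivAt (fun w : C2 => ‖w‖) _ z :=
    (h1.sqrt (by simp [hz])).congr_of_eventuallyEq (Filter.Eventually.of_forall fun w => by simp)
  have h3 := ((hasDerivAt_inv (by simp [hz])).comp_hasFDerivAt z h2).smul (hasFDerivAt_id z)
  refine ⟨_, h3, fun v => ?_⟩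
  have h : inner ℝ z v = (∑ j, conj (z j) * v j).re := by
    simp [PiLp.inner_apply, Complex.inner, mul_comm]
  rw [← h]
  simp [hz, sub_eq_add_neg]

/-- Near the sphere the radial extension differs from `w ↦ P(w, w̄)` to first order only in the
radial direction. -/
lemma fderiv_radialExtension_restrictToSphere (P : Poly) (z : S3) (v : C2) :
    fderiv ℝ (radialExtension (restrictToSphere P)) z.1 v
      = fderiv ℝ (evalConj P) z.1 v
        - (∑ j, conj (z.1 j) * v j).re * fderiv ℝ (evalConj P) z.1 z.1 := by
  have hz : ‖z.1‖ = 1 := mem_sphere_zero_iff_norm.mp z.2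
  have hz0 : z.1 ≠ 0 := by
    rw [← norm_ne_zero_iff, hz]
    exact one_ne_zero
  obtain ⟨D, hD, hD'⟩ := hasFDerivAt_normalize hz
  obtain ⟨E, hE, -⟩ := hasFDerivAt_evalConj P z.1
  have hE' : HasFDerivAt (evalConj P) E ((‖z.1‖⁻¹ : ℝ) • z.1) := by simpa [hz] using hE
  have h := (HasFDerivAt.comp (f := fun w : C2 => (‖w‖⁻¹ : ℝ) • w) z.1 hE' hD).congr_of_eventuallyEq
    (f₁ := radialExtension (restrictToSphere P)) (by
    filter_upwards [isOpen_ne.mem_nhds hz0] with w hw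
    exact radialExtension_restrictToSphere P hw)
  rw [h.fderiv, hE.fderiv, ContinuousLinearMap.comp_apply, hD', map_sub, map_smul]
  simp

lemma fderiv_evalConj (P : Poly) (w v : C2) :
    fderiv ℝ (evalConj P) w v = ∑ j, (evalConj (pderiv (Sum.inl j) P) w * v j
        + evalConj (pderiv (Sum.inr j) P) w * conj (v j)) := by
  obtain ⟨D, hD, hD'⟩ := hasFDerivAt_evalConj P w
  rw [hD.fderiv, hD']

lemma fderiv_radialExtension_restrictToSphere_single_one (P : Poly) (z : S3) (j : Fin 2) :
    fderiv ℝ (radialExtension (restrictToSphere P)) z.1 (EuclideanSpace.single j 1)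
      = evalConj (pderiv (Sum.inl j) P) z.1 + evalConj (pderiv (Sum.inr j) P) z.1
        - (z.1 j).re * fderiv ℝ (evalConj P) z.1 z.1 := by
  rw [fderiv_radialExtension_restrictToSphere, fderiv_evalConj P _ (EuclideanSpace.single j 1)]
  fin_cases j <;> simp

lemma fderiv_radialExtension_restrictToSphere_single_I (P : Poly) (z : S3) (j : Fin 2) :
    fderiv ℝ (radialExtension (restrictToSphere P)) z.1 (EuclideanSpace.single j Complex.I)
      = (evalConj (pderiv (Sum.inl j) P) z.1 - evalConj (pderiv (Sum.inr j) P) z.1) * Complex.I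
        - (z.1 j).im * fderiv ℝ (evalConj P) z.1 z.1 := by
  rw [fderiv_radialExtension_restrictToSphere,
    fderiv_evalConj P _ (EuclideanSpace.single j Complex.I), sub_mul]
  fin_cases j <;> simp [sub_eq_add_neg]

lemma dz_radialExtension_restrictToSphere (P : Poly) (z : S3) (j : Fin 2) :
    dz j (radialExtension (restrictToSphere P)) z.1 = evalConj (pderiv (Sum.inl j) P) z.1
      - conj (z.1 j) / 2 * fderiv ℝ (evalConj P) z.1 z.1 := by
  rw [dz, fderiv_radialExtension_restrictToSphere_single_one,
    fderiv_radialExtension_restrictToSphere_single_I]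
  have h : conj (z.1 j) = (z.1 j).re - (z.1 j).im * Complex.I := by
    apply Complex.ext <;> simp
  linear_combination -(evalConj (pderiv (Sum.inl j) P) z.1
    - evalConj (pderiv (Sum.inr j) P) z.1) / 2 * Complex.I_sq
    + fderiv ℝ (evalConj P) z.1 z.1 / 2 * h

lemma dzbar_radialExtension_restrictToSphere (P : Poly) (z : S3) (j : Fin 2) :
    dzbar j (radialExtension (restrictToSphere P)) z.1 = evalConj (pderiv (Sum.inr j) P) z.1
      - z.1 j / 2 * fderiv ℝ (evalConj P) z.1 z.1 := by
  rw [dzbar, fderiv_radialExtension_restrictToSphere_single_one,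
    fderiv_radialExtension_restrictToSphere_single_I]
  have h : z.1 j = (z.1 j).re + (z.1 j).im * Complex.I := by
    apply Complex.ext <;> simp
  linear_combination (evalConj (pderiv (Sum.inl j) P) z.1
    - evalConj (pderiv (Sum.inr j) P) z.1) / 2 * Complex.I_sq
    + fderiv ℝ (evalConj P) z.1 z.1 / 2 * h

lemma opL_restrictToSphere (P : Poly) :
    opL (restrictToSphere P) = restrictToSphere (polyL P) := by
  funext z
  simp only [opL, dz_radialExtension_restrictToSphere, restrictToSphere_apply, polyL_apply]
  simp only [evalConj, map_sub, map_mul, eval_X, Sum.elim_inr]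
  ring

lemma opLbar_restrictToSphere (P : Poly) :
    opLbar (restrictToSphere P) = restrictToSphere (polyLbar P) := by
  funext z
  simp only [opLbar, dzbar_radialExtension_restrictToSphere, restrictToSphere_apply,
    polyLbar_apply]
  simp only [evalConj, map_sub, map_mul, eval_X, Sum.elim_inl]
  ring

/-! ### The perturbed Kohn Laplacian on harmonic polynomials -/

lemma fischer_polyL_left (P Q : Poly) : fischer (polyL P) Q = -fischer P (polyLbar Q) := by
  have h (i j : Fin 2 ⊕ Fin 2) : fischer (X i * pderiv j P) Q = fischer P (X j * pderiv i Q) := by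
    rw [fischer_X_mul_left, fischer_pderiv_left]
  rw [polyL_apply, polyLbar_apply, fischer_sub_left, fischer_sub_right, h, h]
  ring

lemma fischer_polyLbar_left (P Q : Poly) : fischer (polyLbar P) Q = -fischer P (polyL Q) := by
  rw [← conj_fischer, ← conj_fischer P, fischer_polyL_left, map_neg, neg_neg]

/-- `ℒ̄_t` on polynomials in `z, z̄`. -/
noncomputable def polyLtbar (t : ℂ) : Poly →ₗ[ℂ] Poly := polyLbar + t • polyL

/-- `ℒ_t` on polynomials in `z, z̄`. -/
noncomputable def polyLt (t : ℂ) : Poly →ₗ[ℂ] Poly := polyL + conj t • polyLbar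

/-- `ℒ_t` is minus the adjoint of `ℒ̄_t` for the Fischer inner product. -/
lemma fischer_polyLt_left (t : ℂ) (P Q : Poly) :
    fischer (polyLt t P) Q = -fischer P (polyLtbar t Q) := by
  simp only [polyLt, polyLtbar, LinearMap.add_apply, LinearMap.smul_apply, fischer_add_left,
    fischer_add_right, fischer_smul_left, fischer_smul_right, fischer_polyL_left,
    fischer_polyLbar_left, Complex.conj_conj]
  ring

/-- The constant factor `(1 + |t|²) / (1 - |t|²)²` of the perturbed Kohn Laplacian. -/
noncomputable def boxFactor (t : ℂ) : ℝ := (1 + ‖t‖ ^ 2) / (1 - ‖t‖ ^ 2) ^ 2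

lemma one_le_boxFactor {t : ℂ} (ht : ‖t‖ < 1) : 1 ≤ boxFactor t := by
  have h1 : ‖t‖ ^ 2 < 1 := pow_lt_one₀ (norm_nonneg t) ht two_ne_zero
  have h2 : 0 ≤ ‖t‖ ^ 2 := by positivity
  rw [boxFactor, one_le_div (by nlinarith)]
  nlinarith

/-- `□_b^t` on polynomials in `z, z̄`. -/
noncomputable def polyBox (t : ℂ) : Poly →ₗ[ℂ] Poly :=
  -((boxFactor t : ℂ) • (polyLt t ∘ₗ polyLtbar t))

lemma polyBox_mem_harmonicPoly (t : ℂ) {k : ℕ} {P : Poly} (hP : P ∈ harmonicPoly k) :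
    polyBox t P ∈ harmonicPoly k := by
  have h1 : polyLtbar t P ∈ harmonicPoly k :=
    add_mem (polyLbar_mem_harmonicPoly hP) (Submodule.smul_mem _ _ (polyL_mem_harmonicPoly hP))
  exact neg_mem (Submodule.smul_mem _ _ (add_mem (polyL_mem_harmonicPoly h1)
    (Submodule.smul_mem _ _ (polyLbar_mem_harmonicPoly h1))))

lemma boxbt_restrictToSphere (t : ℂ) (P : Poly) :
    boxbt t (restrictToSphere P) = restrictToSphere (polyBox t P) := by
  have h1 : opLtbar t (restrictToSphere P) = restrictToSphere (polyLtbar t P) := by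
    simp [opLtbar, polyLtbar, opL_restrictToSphere, opLbar_restrictToSphere]
  have h2 (Q : Poly) : opLt t (restrictToSphere Q) = restrictToSphere (polyLt t Q) := by
    simp [opLt, polyLt, opL_restrictToSphere, opLbar_restrictToSphere]
  rw [boxbt, h1, ← map_smul, h2]
  simp [polyBox, boxFactor]

lemma fischer_polyBox_left (t : ℂ) (P Q : Poly) :
    fischer (polyBox t P) Q = boxFactor t * fischer (polyLtbar t P) (polyLtbar t Q) := by
  rw [polyBox, LinearMap.neg_apply, LinearMap.smul_apply, LinearMap.comp_apply, fischer_neg_left,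
    fischer_smul_left, fischer_polyLt_left, Complex.conj_ofReal]
  ring

lemma fischer_polyBox_right (t : ℂ) (P Q : Poly) :
    fischer P (polyBox t Q) = boxFactor t * fischer (polyLtbar t P) (polyLtbar t Q) := by
  rw [← conj_fischer, fischer_polyBox_left, map_mul, Complex.conj_ofReal, conj_fischer]

lemma fischer_polyBox_self_re (t : ℂ) (P : Poly) :
    (fischer (polyBox t P) P).re
      = boxFactor t * (fischer (polyLtbar t P) (polyLtbar t P)).re := by
  rw [fischer_polyBox_left, Complex.re_ofReal_mul]

/-! ### Bounds for the quadratic form -/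

lemma fischer_X_mul_pderiv_sub_self_re_le {k : ℕ} {P : Poly} (hP : P.IsHomogeneous k)
    (i j i' j' : Fin 2 ⊕ Fin 2) :
    (fischer (X i * pderiv j P - X i' * pderiv j' P)
      (X i * pderiv j P - X i' * pderiv j' P)).re ≤ 4 * (k : ℝ) ^ 2 * (fischer P P).re := by
  have h := fischer_add_self_re_le (X i * pderiv j P) (-(X i' * pderiv j' P))
  rw [← sub_eq_add_neg, fischer_neg_left, fischer_neg_right, neg_neg] at h
  have h1 := fischer_X_mul_pderiv_self_re_le hP i j
  have h2 := fischer_X_mul_pderiv_self_re_le hP i' j'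
  linarith

lemma fischer_polyLtbar_self_re_le {t : ℂ} (ht : ‖t‖ < 1) {k : ℕ} {P : Poly}
    (hP : P.IsHomogeneous k) :
    (fischer (polyLtbar t P) (polyLtbar t P)).re ≤ 16 * (k : ℝ) ^ 2 * (fischer P P).re := by
  have h : (fischer (polyLtbar t P) (polyLtbar t P)).re
      ≤ 2 * (fischer (polyLbar P) (polyLbar P)).re
        + 2 * (‖t‖ ^ 2 * (fischer (polyL P) (polyL P)).re) := by
    rw [← fischer_smul_self_re]
    exact fischer_add_self_re_le _ _
  have h1 : (fischer (polyLbar P) (polyLbar P)).re ≤ 4 * (k : ℝ) ^ 2 * (fischer P P).re :=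
    fischer_X_mul_pderiv_sub_self_re_le hP _ _ _ _
  have h2 : (fischer (polyL P) (polyL P)).re ≤ 4 * (k : ℝ) ^ 2 * (fischer P P).re :=
    fischer_X_mul_pderiv_sub_self_re_le hP _ _ _ _
  have h3 : ‖t‖ ^ 2 * (fischer (polyL P) (polyL P)).re ≤ (fischer (polyL P) (polyL P)).re :=
    mul_le_of_le_one_left (fischer_self_re_nonneg _) (pow_le_one₀ (norm_nonneg t) ht.le)
  linarith

/-- The harmonic monomial `z₁^p z̄₂^q`. -/
noncomputable def biMonomial (p q : ℕ) : Poly :=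
  monomial (Finsupp.single (Sum.inl 0) p + Finsupp.single (Sum.inr 1) q) 1

lemma biMonomial_eq (p q : ℕ) : biMonomial p q = X (Sum.inl 0) ^ p * X (Sum.inr 1) ^ q := by
  rw [biMonomial, X_pow_eq_monomial, X_pow_eq_monomial, monomial_mul, one_mul]

lemma biMonomial_ne_zero (p q : ℕ) : biMonomial p q ≠ 0 := by
  simp [biMonomial]

lemma biMonomial_mem_harmonicPoly (p q : ℕ) : biMonomial p q ∈ harmonicPoly (p + q) := by
  refine ⟨isHomogeneous_monomial _ (by simp), ?_⟩
  change laplacian (biMonomial p q) = 0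
  simp [laplacian_apply, biMonomial_eq, pderiv_X]

lemma polyL_biMonomial (p q : ℕ) :
    polyL (biMonomial (p + 1) q) = -((p + 1 : ℂ) • biMonomial p (q + 1)) := by
  simp [polyL_apply, biMonomial_eq, pderiv_X, smul_eq_C_mul]
  ring

lemma polyL_biMonomial_zero (q : ℕ) : polyL (biMonomial 0 q) = 0 := by
  simp [polyL_apply, biMonomial_eq, pderiv_X]

lemma polyLbar_biMonomial (p q : ℕ) :
    polyLbar (biMonomial p (q + 1)) = (q + 1 : ℂ) • biMonomial (p + 1) q := by
  simp [polyLbar_apply, biMonomial_eq, pderiv_X, smul_eq_C_mul]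
  ring

/-- `ℒ̄` and `ℒ` move `z₁^p z̄₂^q` to different bidegrees, so the two parts of its image under
`ℒ̄_t` are orthogonal. -/
lemma fischer_polyLbar_polyL_biMonomial (p q : ℕ) :
    fischer (polyLbar (biMonomial p (q + 1))) (polyL (biMonomial p (q + 1))) = 0 := by
  obtain _ | p := p
  · rw [polyL_biMonomial_zero]
    simp [fischer]
  · rw [polyLbar_biMonomial, polyL_biMonomial, fischer_smul_left, fischer_neg_right,
      fischer_smul_right, biMonomial, fischer_monomial_left, biMonomial, coeff_monomial, if_neg]
    · simp
    · intro h
      have := DFunLike.congr_fun h (Sum.inl 0)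
      simp at this
      lia

lemma fischer_polyLbar_self_biMonomial (p q : ℕ) :
    fischer (polyLbar (biMonomial p (q + 1))) (polyLbar (biMonomial p (q + 1)))
      = ((q + 1) * (p + 1) : ℕ) * fischer (biMonomial p (q + 1)) (biMonomial p (q + 1)) := by
  nth_rewrite 2 [polyLbar_biMonomial]
  rw [fischer_polyLbar_left, map_smul, polyL_biMonomial, fischer_smul_right, fischer_neg_right,
    fischer_smul_right]
  push_cast
  ring

lemma le_fischer_polyLtbar_biMonomial (t : ℂ) (p q : ℕ) :
    (q + 1) * (p + 1) * (fischer (biMonomial p (q + 1)) (biMonomial p (q + 1))).re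
      ≤ (fischer (polyLtbar t (biMonomial p (q + 1)))
          (polyLtbar t (biMonomial p (q + 1)))).re := by
  have h1 := fischer_polyLbar_polyL_biMonomial p q
  have h2 : fischer (polyL (biMonomial p (q + 1))) (polyLbar (biMonomial p (q + 1))) = 0 := by
    rw [← conj_fischer, h1, map_zero]
  have h3 := congrArg Complex.re (fischer_polyLbar_self_biMonomial p q)
  rw [← Complex.ofReal_natCast, Complex.re_ofReal_mul] at h3
  have h4 := fischer_self_re_nonneg (t • polyL (biMonomial p (q + 1)))
  rw [polyLtbar, LinearMap.add_apply, LinearMap.smul_apply, fischer_add_left, fischer_add_right,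
    fischer_add_right, fischer_smul_right _ (polyLbar _), fischer_smul_left _ _ (polyLbar _), h1,
    h2, mul_zero, mul_zero, add_zero, zero_add, Complex.add_re, h3]
  push_cast
  linarith

lemma exists_le_fischer_polyLtbar (t : ℂ) (k : ℕ) :
    ∃ P ∈ harmonicPoly k, P ≠ 0 ∧
      (k : ℝ) ^ 2 / 4 * (fischer P P).re ≤ (fischer (polyLtbar t P) (polyLtbar t P)).re := by
  obtain _ | k := k
  · refine ⟨biMonomial 0 0, biMonomial_mem_harmonicPoly 0 0, biMonomial_ne_zero 0 0, ?_⟩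
    simpa using fischer_self_re_nonneg _
  · -- The balanced bidegree makes `(p + 1) q` quadratic in `k`.
    have hk : (k + 1) / 2 + (k / 2 + 1) = k + 1 := by omega
    refine ⟨biMonomial ((k + 1) / 2) (k / 2 + 1), ?_, biMonomial_ne_zero _ _, ?_⟩
    · have h := biMonomial_mem_harmonicPoly ((k + 1) / 2) (k / 2 + 1)
      rwa [hk] at h
    refine le_trans (mul_le_mul_of_nonneg_right ?_ (fischer_self_re_nonneg _))
      (le_fischer_polyLtbar_biMonomial t _ _)
    rw [div_le_iff₀ (by norm_num)]
    have h : (k + 1) ^ 2 ≤ (k / 2 + 1) * ((k + 1) / 2 + 1) * 4 := by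
      obtain ⟨m, rfl | rfl⟩ := k.even_or_odd'
      · rw [show 2 * m / 2 = m by omega, show (2 * m + 1) / 2 = m by omega]
        nlinarith
      · rw [show (2 * m + 1) / 2 = m by omega, show (2 * m + 1 + 1) / 2 = m + 1 by omega]
        nlinarith
    exact_mod_cast h

/-! ### The spectrum on spherical harmonics -/

/-- The Fischer inner product on `H_k(ℂ²)`. -/
noncomputable abbrev fischerCore (k : ℕ) : InnerProductSpace.Core ℂ (harmonicPoly k) where
  inner P Q := fischer P.1 Q.1
  conj_inner_symm P Q := conj_fischer P.1 Q.1
  re_inner_nonneg P := fischer_self_re_nonneg P.1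
  add_left P Q R := fischer_add_left P.1 Q.1 R.1
  smul_left P Q r := fischer_smul_left r P.1 Q.1
  definite P h := by
    by_contra hP
    have := fischer_self_re_pos (P := P.1) (by simpa using hP)
    rw [h] at this
    simp at this

instance finiteDimensional_harmonicPoly (k : ℕ) : FiniteDimensional ℂ (harmonicPoly k) := by
  have : FiniteDimensional ℂ (homogeneousSubmodule (Fin 2 ⊕ Fin 2) ℂ k) :=
    Module.Finite.iff_fg.mpr (homogeneousSubmodule_fg _ _ k)
  exact Submodule.finiteDimensional_of_le inf_le_left

/-- Eigenvalues on `H_k(S³)` are eigenvalues on harmonic polynomials, as the restriction to the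
sphere is injective on `H_k(ℂ²)`. -/
lemma mem_eigenvaluesOn_iff (t : ℂ) (k : ℕ) (μ : ℂ) :
    μ ∈ eigenvaluesOn t k ↔ ∃ P ∈ harmonicPoly k, P ≠ 0 ∧ polyBox t P = μ • P := by
  constructor
  · rintro ⟨_, ⟨P, hP, rfl⟩, hne, h⟩
    refine ⟨P, hP, fun h0 => hne (by rw [h0, map_zero]), ?_⟩
    rw [boxbt_restrictToSphere, ← map_smul, ← sub_eq_zero, ← map_sub] at h
    have hmem : polyBox t P - μ • P ∈ harmonicPoly k :=
      sub_mem (polyBox_mem_harmonicPoly t hP) (Submodule.smul_mem _ _ hP)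
    exact sub_eq_zero.mp (eq_zero_of_restrictToSphere_eq_zero hmem.1 h)
  · rintro ⟨P, hP, hne, h⟩
    refine ⟨restrictToSphere P, ⟨P, hP, rfl⟩,
      fun h0 => hne (eq_zero_of_restrictToSphere_eq_zero hP.1 h0), ?_⟩
    rw [boxbt_restrictToSphere, h, map_smul]

lemma im_eq_zero_of_mem_eigenvaluesOn {t : ℂ} {k : ℕ} {μ : ℂ} (h : μ ∈ eigenvaluesOn t k) :
    μ.im = 0 := by
  obtain ⟨P, -, hne, hP⟩ := (mem_eigenvaluesOn_iff t k μ).mp h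
  have h1 : fischer (polyBox t P) P = fischer P (polyBox t P) := by
    rw [fischer_polyBox_left, fischer_polyBox_right]
  rw [hP, fischer_smul_left, fischer_smul_right] at h1
  have h0 : fischer P P ≠ 0 := fun h0 => by
    have := fischer_self_re_pos hne
    simp [h0] at this
  exact Complex.conj_eq_iff_im.mp (mul_right_cancel₀ h0 h1)

/-- The largest eigenvalue on `H_k(S³)` is attained and is the maximum of the Rayleigh quotient. -/
lemma isGreatest_lambdaMax_and_rayleigh_le (t : ℂ) (k : ℕ) :
    IsGreatest {r : ℝ | (r : ℂ) ∈ eigenvaluesOn t k} (lambdaMax t k) ∧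
      ∀ P ∈ harmonicPoly k, (fischer (polyBox t P) P).re ≤ lambdaMax t k * (fischer P P).re := by
  obtain ⟨P₀, hP₀, hne₀, -⟩ := exists_le_fischer_polyLtbar t k
  have : Nontrivial (harmonicPoly k) :=
    ⟨⟨P₀, hP₀⟩, 0, fun h => hne₀ (congrArg Subtype.val h)⟩
  obtain ⟨r, hr, hle⟩ := exists_hasEigenvalue_re_inner_le (fischerCore k)
    ((polyBox t).restrict fun P hP => polyBox_mem_harmonicPoly t hP)
    (fun P Q => by
      change fischer (polyBox t P.1) Q.1 = fischer P.1 (polyBox t Q.1)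
      rw [fischer_polyBox_left, fischer_polyBox_right])
  have hle' : ∀ P ∈ harmonicPoly k,
      (fischer (polyBox t P) P).re ≤ r * (fischer P P).re := fun P hP => hle ⟨P, hP⟩
  have hgreatest : IsGreatest {r : ℝ | (r : ℂ) ∈ eigenvaluesOn t k} r := by
    constructor
    · obtain ⟨v, hv⟩ := hr.exists_hasEigenvector
      exact (mem_eigenvaluesOn_iff t k r).mpr
        ⟨v.1, v.2, by simpa using hv.2, congrArg Subtype.val hv.apply_eq_smul⟩
    · intro s hs
      obtain ⟨P, hP, hne, h⟩ := (mem_eigenvaluesOn_iff t k s).mp hs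
      have h1 := hle' P hP
      rw [h, fischer_smul_left, Complex.conj_ofReal, Complex.re_ofReal_mul] at h1
      exact le_of_mul_le_mul_right h1 (fischer_self_re_pos hne)
  have heq : lambdaMax t k = r := hgreatest.csSup_eq
  rw [heq]
  exact ⟨hgreatest, hle'⟩

lemma lambdaMax_le {t : ℂ} (ht : ‖t‖ < 1) (k : ℕ) :
    lambdaMax t k ≤ 16 * boxFactor t * (k : ℝ) ^ 2 := by
  obtain ⟨P, hP, hne, h⟩ :=
    (mem_eigenvaluesOn_iff t k _).mp (isGreatest_lambdaMax_and_rayleigh_le t k).1.1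
  have h1 := fischer_polyBox_self_re t P
  rw [h, fischer_smul_left, Complex.conj_ofReal, Complex.re_ofReal_mul] at h1
  have h2 := mul_le_mul_of_nonneg_left (fischer_polyLtbar_self_re_le ht hP.1)
    (zero_le_one.trans (one_le_boxFactor ht))
  refine le_of_mul_le_mul_right ?_ (fischer_self_re_pos hne)
  linarith

lemma le_lambdaMax {t : ℂ} (ht : ‖t‖ < 1) (k : ℕ) : (k : ℝ) ^ 2 / 4 ≤ lambdaMax t k := by
  obtain ⟨P, hP, hne, h⟩ := exists_le_fischer_polyLtbar t k
  have h1 := (isGreatest_lambdaMax_and_rayleigh_le t k).2 P hP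
  rw [fischer_polyBox_self_re] at h1
  have h2 := le_mul_of_one_le_left (fischer_self_re_nonneg (polyLtbar t P)) (one_le_boxFactor ht)
  exact le_of_mul_le_mul_right (h.trans (h2.trans h1)) (fischer_self_re_pos hne)

end RossiSphere

theorem mainTheorem3 (t : ℂ) (ht : ‖t‖ < 1) :
    -- `□_b^t` maps each `H_k(S³)` to itself, all its eigenvalues there are real, and the number
    -- `λ_k^max` is indeed the largest of them
    (∀ k : ℕ,
      Set.MapsTo (RossiSphere.boxbt t) (RossiSphere.sphericalHarmonics k)
        (RossiSphere.sphericalHarmonics k) ∧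
      (∀ μ ∈ RossiSphere.eigenvaluesOn t k, μ.im = 0) ∧
      IsGreatest {r : ℝ | (r : ℂ) ∈ RossiSphere.eigenvaluesOn t k} (RossiSphere.lambdaMax t k)) ∧
    -- the two-sided quadratic bound, for every `k`, and its asymptotic form
    (∃ c : ℝ, 0 < c ∧ ∀ k : ℕ,
      1 / c * (k : ℝ) ^ 2 ≤ RossiSphere.lambdaMax t k ∧
        RossiSphere.lambdaMax t k ≤ c * (k : ℝ) ^ 2) ∧
    (fun k : ℕ => RossiSphere.lambdaMax t k) =Θ[atTop] (fun k : ℕ => (k : ℝ) ^ 2) := by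
  have hC := RossiSphere.one_le_boxFactor ht
  have hlow := RossiSphere.le_lambdaMax ht
  have hup := RossiSphere.lambdaMax_le ht
  refine ⟨fun k => ⟨?_, fun μ hμ => RossiSphere.im_eq_zero_of_mem_eigenvaluesOn hμ,
    (RossiSphere.isGreatest_lambdaMax_and_rayleigh_le t k).1⟩,
    ⟨16 * RossiSphere.boxFactor t, by linarith, fun k => ⟨?_, hup k⟩⟩, ?_, ?_⟩
  · rintro _ ⟨P, hP, rfl⟩
    rw [RossiSphere.boxbt_restrictToSphere]
    exact ⟨_, RossiSphere.polyBox_mem_harmonicPoly t hP, rfl⟩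
  · refine le_trans ?_ (hlow k)
    rw [div_eq_inv_mul _ (4 : ℝ), one_div]
    gcongr
    linarith
  · refine IsBigO.of_bound (16 * RossiSphere.boxFactor t) (Eventually.of_forall fun k => ?_)
    rw [Real.norm_of_nonneg ((by positivity : (0 : ℝ) ≤ (k : ℝ) ^ 2 / 4).trans (hlow k)),
      Real.norm_of_nonneg (by positivity)]
    exact hup k
  · refine IsBigO.of_bound 4 (Eventually.of_forall fun k => ?_)
    rw [Real.norm_of_nonneg ((by positivity : (0 : ℝ) ≤ (k : ℝ) ^ 2 / 4).trans (hlow k)),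
      Real.norm_of_nonneg (by positivity)]
    linarith [hlow k]
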